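/- **Theorem 5.12.** Let $f_0:\mathbb R^n\to\mathbb R$, $F:\mathbb R^n\to\mathbb R^m$, $G:\mathbb R^\ell\to\mathbb R^p$, $H:\mathbb R^\ell\to\mathbb R^m$ be twice continuously differentiable, let $D\subset\mathbb R^p$ be closed, and put $$Q:=\{z\in\mathbb R^\ell : G(z)\in D\},\qquad C:=H(Q),\qquad \Phi(y):=\{z\in\mathbb R^\ell : G(z)\in D,\ H(z)=y\}\quad(y\in\mathbb R^m).$$ Consider the problem $(\mathrm P)$: $\min\{f_0(x) : F(x)\in C\}$, and let $\bar x$ be feasible, i.e. $F(\bar x)\in C$. *Notation.* All spaces carry the Euclidean inner product and norm. For a set $S$ and $\bar z\in S$, the tangent cone $T_S(\bar z)$ consists of all $w$ for which there are $t_k\downarrow0$, $w_k\to w$ with $\bar z+t_kw_k\in S$ for all $k$. If $w\in T_S(\bar z)$, then $\widehat N^p_S(\bar z;w)$ is the set of all $z^*$ with $\langle z^*,w\rangle=0$ for which there is $\gamma>0$ such that for all $t_k\downarrow0$, $w_k\to w$ with $\bar z+t_kw_k\in S$ for all $k$ one has $\langle z^*,w_k\rangle\le\gamma t_k\|w_k\|^2$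 for all sufficiently large $k$; if $w\notin T_S(\bar z)$, then $\widehat N^p_S(\bar z;w):=\varnothing$. With $\delta_S$ the indicator function ($0$ on $S$, $+\infty$ elsewhere), the second subderivative is $${\rm d}^2\delta_S(\bar z;z^*)(w):=\liminf_{t\downarrow0,\;w'\to w}\frac{\delta_S(\bar z+tw')-\delta_S(\bar z)-t\langle z^*,w'\rangle}{\frac12t^2}\in[-\infty,\infty].$$ For $\alpha\ge0$ let $L^\alpha(x,\lambda):=\alpha f_0(x)+\langle\lambda,F(x)\rangle$ and $\Lambda^\alpha(\bar x):=\{\lambda\in\mathbb R^m : \nabla_xL^\alpha(\bar x,\lambda)=0\}$. Further let $$\vartheta(z,w,\lambda,\eta):=\langle\eta,\nabla^2G(z)(w,w)\rangle-\langle\lambda,\nabla^2H(z)(w,w)\rangle+{\rm d}^2\delta_D(G(z);\eta)(\nabla G(z)w),$$ $$\Sigma(z,w,\lambda):=\{\eta\in\widehat N^p_D(G(z);\nabla G(z)w) : \nabla G(z)^\top\eta=\nabla H(z)^\top\lambda\}.$$ *Assumptions on $\Phi$.* $\Phi$ is inner semicompact at $F(\bar x)$ w.r.t. $C$: for every sequence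 $y_k\to F(\bar x)$ in $C$ there are a subsequence $y_{k_j}$ and points $z_j\in\Phi(y_{k_j})$ that converge to some $z\in\mathbb R^\ell$. Moreover, $\Phi$ is inner calm* at $F(\bar x)$ w.r.t. $C$: there is $\kappa>0$ such that for every sequence $y_k\to F(\bar x)$ in $C$ there are a subsequence $y_{k_j}$ and points $z_j\in\Phi(y_{k_j})$ converging to some $z\in\mathbb R^\ell$ with $\|z_j-z\|\le\kappa\|y_{k_j}-F(\bar x)\|$ for all $j$. *Second-order condition.* Assume that for each $u\in\mathbb R^n\setminus\{0\}$ satisfying $$\nabla F(\bar x)u\in\bigcup_{z\in\Phi(F(\bar x))}\{\nabla H(z)w : w\in\mathbb R^\ell,\ \nabla G(z)w\in T_D(G(z))\},\qquad\langle\nabla f_0(\bar x),u\rangle\le0,$$ there are $\alpha\ge0$ and $\lambda\in\Lambda^\alpha(\bar x)$ such that for each $z\in\Phi(F(\bar x))$ and each $w\in\mathbb R^\ell$ satisfying $\nabla H(z)w=\nabla F(\bar x)u$ and $\nabla G(z)w\in T_D(G(z))$ there is $\eta\in\Sigma(z,w,\lambda)$ with $$\nabla^2_{xx}L^\alpha(\bar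 x,\lambda)(u,u)+\vartheta(z,w,\lambda,\eta)>0.$$ *Conclusion.* Then $\bar x$ is an essential local minimizer of second order for $(\mathrm P)$: $\bar x$ is feasible and there are $\varepsilon>0$, $\delta>0$ such that $$\max\{f_0(x)-f_0(\bar x),\ \operatorname{dist}(F(x),C)\}\ \ge\ \varepsilon\|x-\bar x\|^2\qquad\text{for all }x\text{ with }\|x-\bar x\|\le\delta.$$ -/

import Mathlib

open Set Filter Topology

noncomputable section

namespace SecondOrder

section General

variable {E E' : Type*} [NormedAddCommGroup E] [InnerProductSpace ℝ E]
  [NormedAddCommGroup E'] [InnerProductSpace ℝ E']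

/-- The Bouligand (contingent) tangent cone `T_S(x)`: all `w` for which there are `t_k ↓ 0` and
`w_k → w` with `x + t_k w_k ∈ S` for all `k`. -/
def tangentCone (S : Set E) (x : E) : Set E :=
  {w | ∃ (t : ℕ → ℝ) (v : ℕ → E), (∀ k, 0 < t k) ∧ Tendsto t atTop (𝓝 0) ∧
    Tendsto v atTop (𝓝 w) ∧ ∀ k, x + t k • v k ∈ S}

open Classical in
/-- The directional proximal pre-normal cone to `S` at `x` in direction `w`; it is empty unless
`w` is tangent to `S` at `x`. -/
def proxPreNormalCone (S : Set E) (x w : E) : Set E :=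
  if w ∈ tangentCone S x then
    {y | ∃ γ > (0 : ℝ), ∀ (t : ℕ → ℝ) (v : ℕ → E), (∀ k, 0 < t k) → Tendsto t atTop (𝓝 0) →
      Tendsto v atTop (𝓝 w) → (∀ k, x + t k • v k ∈ S) →
      ∀ᶠ k in atTop, inner ℝ y (v k) ≤ γ * t k * ‖v k‖ ^ 2}
  else ∅

/-- The directional proximal normal cone to `S` at `x` in direction `w`: the pre-normal cone
intersected with the annihilator of `w`. -/
def proxNormalCone (S : Set E) (x w : E) : Set E :=
  proxPreNormalCone S x w ∩ {y | inner ℝ y w = 0}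

open Classical in
/-- The indicator function `δ_S` of convex analysis, `0` on `S` and `+∞` elsewhere. -/
def indicatorFun (S : Set E) : E → EReal := fun x => if x ∈ S then 0 else ⊤

/-- The second subderivative `d²h(x; y)(w)`: the lower limit, as `t ↓ 0` and `w' → w`, of
`(h (x + t w') - h x - t ⟨y, w'⟩) / (t² / 2)`. -/
def secondSubderiv (h : E → EReal) (x y w : E) : EReal :=
  liminf (fun p : ℝ × E =>
      (h (x + p.1 • p.2) - h x - ((p.1 * inner ℝ y p.2 : ℝ) : EReal))
        / ((p.1 ^ 2 / 2 : ℝ) : EReal))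
    (𝓝[>] (0 : ℝ) ×ˢ 𝓝 w)

/-- The second derivative `∇²g(x)(w, w)` of a (possibly vector-valued) mapping; for `g` with values
in `ℝᵐ`, its `i`-th component is the Hessian form of `g_i` at `(w, w)`. -/
def hessForm (g : E → E') (x w : E) : E' := fderiv ℝ (fderiv ℝ g) x w w

/-- `Γ` is inner semicompact at `x₀` with respect to `Ω`. -/
def InnerSemicompactAt (Γ : E → Set E') (x₀ : E) (Ω : Set E) : Prop :=
  ∀ x : ℕ → E, (∀ k, x k ∈ Ω) → Tendsto x atTop (𝓝 x₀) →
    ∃ (y : E') (φ : ℕ → ℕ) (ys : ℕ → E'), StrictMono φ ∧ Tendsto ys atTop (𝓝 y) ∧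
      ∀ l, ys l ∈ Γ (x (φ l))

/-- `Γ` is inner calm* at `x₀` with respect to `Ω`. -/
def InnerCalmStarAt (Γ : E → Set E') (x₀ : E) (Ω : Set E) : Prop :=
  ∃ κ > (0 : ℝ), ∀ x : ℕ → E, (∀ k, x k ∈ Ω) → Tendsto x atTop (𝓝 x₀) →
    ∃ (y : E') (φ : ℕ → ℕ) (ys : ℕ → E'), StrictMono φ ∧ Tendsto ys atTop (𝓝 y) ∧
      ∀ l, ys l ∈ Γ (x (φ l)) ∧ ‖ys l - y‖ ≤ κ * ‖x (φ l) - x₀‖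

/-- `x₀` is an essential local minimizer of second order for `min f₀(x)` s.t. `F x ∈ C`. -/
def IsEssentialLocalMin (f₀ : E → ℝ) (F : E → E') (C : Set E') (x₀ : E) : Prop :=
  F x₀ ∈ C ∧ ∃ ε > (0 : ℝ), ∃ δ > (0 : ℝ), ∀ x ∈ Metric.closedBall x₀ δ,
    ε * ‖x - x₀‖ ^ 2 ≤ max (f₀ x - f₀ x₀) (Metric.infDist (F x) C)

/-- The Lagrangian `L^α(x, lam) = α f₀(x) + ⟨lam, F(x)⟩`. -/
def lagrangian (f₀ : E → ℝ) (F : E → E') (α : ℝ) (x : E) (lam : E') : ℝ :=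
  α * f₀ x + inner ℝ lam (F x)

/-- The multiplier set `Λ^α(x) = {lam | ∇ₓ L^α(x, lam) = 0}`. -/
def multipliers [CompleteSpace E] (f₀ : E → ℝ) (F : E → E') (α : ℝ) (x : E) : Set E' :=
  {lam | gradient (fun x' => lagrangian f₀ F α x' lam) x = 0}

end General

section ImagePreimage

variable {Y Z P : Type*}
  [NormedAddCommGroup Y] [InnerProductSpace ℝ Y] [CompleteSpace Y]
  [NormedAddCommGroup Z] [InnerProductSpace ℝ Z] [CompleteSpace Z]
  [NormedAddCommGroup P] [InnerProductSpace ℝ P] [CompleteSpace P]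

/-- The set `C = H(Q)` with `Q = {z | G z ∈ D}`. -/
def imagePreimage (G : Z → P) (H : Z → Y) (D : Set P) : Set Y := H '' {z | G z ∈ D}

/-- The mapping `Φ(y) = {z | G z ∈ D, H z = y}`. -/
def implicitMap (G : Z → P) (H : Z → Y) (D : Set P) (y : Y) : Set Z := {z | G z ∈ D ∧ H z = y}

/-- The multiplier set
`Σ(z, w, lam) = {η ∈ N̂ᵖ_D(G z; ∇G(z)w) | ∇G(z)ᵀ η = ∇H(z)ᵀ lam}`. -/
def innerMultipliers (G : Z → P) (H : Z → Y) (D : Set P) (z w : Z) (lam : Y) : Set P :=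
  {η | η ∈ proxNormalCone D (G z) (fderiv ℝ G z w) ∧
    (fderiv ℝ G z).adjoint η = (fderiv ℝ H z).adjoint lam}

/-- The (extended real-valued) function
`ϑ(z, w, lam, η) = ⟨η, ∇²G(z)(w,w)⟩ - ⟨lam, ∇²H(z)(w,w)⟩ + d²δ_D(G z; η)(∇G(z)w)`. -/
def theta (G : Z → P) (H : Z → Y) (D : Set P) (z w : Z) (lam : Y) (η : P) : EReal :=
  ((inner ℝ η (hessForm G z w) - inner ℝ lam (hessForm H z w) : ℝ) : EReal)
    + secondSubderiv (indicatorFun D) (G z) η (fderiv ℝ G z w)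

end ImagePreimage

end SecondOrder

end

/-! Argue by contradiction. If quadratic growth fails, there are `x + t_k u_k` with `u_k → u₀ ≠ 0`
at which `f₀` rises, and `F` misses `C`, by at most `o(t_k²)`. Inner calmness* bounds the preimages'
displacement linearly, so the nearby points of `C` can be written as `H (z + t_k w_k)` with `w_k →
w₀` (`exists_lifted_seq_of_not_isEssentialLocalMin`). First-order quotients show that `u₀` is
critical and `w₀` admissible at `z`, so the second-order condition supplies multipliers. Weighting
the two estimates by `α` and `lam` bounds the increment of the Lagrangian by that of `⟨lam, H⟩` up
to `o(t_k²)`. Stationarity and the adjoint equation for `η` cancel all first-order terms. After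
division by `t_k² / 2`, the quotients of `G` are test directions for the second subderivative, and
the limit contradicts positivity (`hessForm_lagrangian_add_theta_nonpos`). -/

namespace SecondOrder

open Asymptotics

section Taylor

variable {E E' : Type*} [NormedAddCommGroup E] [NormedSpace ℝ E]
  [NormedAddCommGroup E'] [NormedSpace ℝ E']

/-- The second-order Taylor expansion with Peano remainder. -/
theorem isLittleO_taylor_two {g : E → E'} (hg : ContDiff ℝ 2 g) (x : E) :
    (fun y => g y - g x - fderiv ℝ g x (y - x)
      - (1 / 2 : ℝ) • fderiv ℝ (fderiv ℝ g) x (y - x) (y - x)) =o[𝓝 x]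
      fun y => ‖y - x‖ ^ 2 := by
  set B := fderiv ℝ (fderiv ℝ g) x
  have hsymm : ∀ a b, B a b = B b a :=
    (hg.contDiffAt (x := x)).isSymmSndFDerivAt (by simp)
  have hg' : Differentiable ℝ g := hg.differentiable (by norm_num)
  have hgg : DifferentiableAt ℝ (fderiv ℝ g) x :=
    (hg.fderiv_right (m := 1) (by norm_num)).differentiable (by norm_num) x
  have hderiv : ∀ y, HasFDerivAt (fun y => g y - g x - fderiv ℝ g x (y - x)
      - (1 / 2 : ℝ) • B (y - x) (y - x)) (fderiv ℝ g y - fderiv ℝ g x - B (y - x)) y := by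
    intro y
    have h1 : HasFDerivAt (fun y => y - x) (ContinuousLinearMap.id ℝ E) y :=
      (hasFDerivAt_id y).sub_const x
    have h2 : HasFDerivAt (fun y => fderiv ℝ g x (y - x)) (fderiv ℝ g x) y := by
      exact (fderiv ℝ g x).hasFDerivAt.comp y h1
    have h3 : HasFDerivAt (fun y => B (y - x)) B y := by
      exact B.hasFDerivAt.comp y h1
    have h4 := h3.clm_apply h1
    refine ((((hg' y).hasFDerivAt.sub_const (g x)).sub h2).sub
      (h4.const_smul (1 / 2 : ℝ))).congr_fderiv ?_
    ext v
    have h5 : (1 / 2 : ℝ) • (B (y - x) v + B (y - x) v) = B (y - x) v := by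
      rw [← two_smul ℝ, smul_smul]; norm_num
    change fderiv ℝ g y v - fderiv ℝ g x v - (1 / 2 : ℝ) • (B (y - x) v + B v (y - x)) =
      fderiv ℝ g y v - fderiv ℝ g x v - B (y - x) v
    rw [hsymm v (y - x), h5]
  have hlit : (fun y => fderiv ℝ g y - fderiv ℝ g x - B (y - x)) =o[𝓝[univ] x]
      fun y => ‖y - x‖ ^ 1 := by
    simpa using hgg.hasFDerivAt.isLittleO.norm_right
  -- Mean value inequality: the remainder's derivative is `o(‖y - x‖)`, so the remainder gains one
  -- order.
  have := convex_univ.isLittleO_pow_succ (mem_univ x)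
    (fun y _ => (hderiv y).hasFDerivWithinAt) hlit
  simpa using this

variable {x w : E} {t : ℕ → ℝ} {v : ℕ → E}

theorem tendsto_add_smul (ht : Tendsto t atTop (𝓝 0)) (hv : Tendsto v atTop (𝓝 w)) :
    Tendsto (fun k => x + t k • v k) atTop (𝓝 x) := by
  simpa using tendsto_const_nhds.add (ht.smul hv)

theorem tendsto_differenceQuotient {g : E → E'} (hg : DifferentiableAt ℝ g x)
    (htpos : ∀ k, 0 < t k) (ht : Tendsto t atTop (𝓝 0)) (hv : Tendsto v atTop (𝓝 w)) :
    Tendsto (fun k => (t k)⁻¹ • (g (x + t k • v k) - g x)) atTop (𝓝 (fderiv ℝ g x w)) := by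
  have hlit : (fun k => g (x + t k • v k) - g x - fderiv ℝ g x (t k • v k)) =o[atTop] t := by
    have h1 := hg.hasFDerivAt.isLittleO.comp_tendsto (tendsto_add_smul (x := x) ht hv)
    have h2 : (fun k => t k • v k) =O[atTop] t := by
      simpa using (isBigO_refl t atTop).smul (hv.isBigO_one ℝ)
    simpa [Function.comp_def] using
      IsLittleO.trans_isBigO (by simpa [Function.comp_def] using h1) h2
  have h3 := hlit.tendsto_inv_smul_nhds_zero.add (((fderiv ℝ g x).continuous.tendsto w).comp hv)
  simp only [zero_add] at h3
  refine h3.congr fun k => ?_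
  simp only [Function.comp_apply, map_smul, smul_sub, inv_smul_smul₀ (htpos k).ne']
  abel

/-- The first-order term is evaluated at the moving `v k`, not at `w`, so no rate for `v k → w` is
needed. The factor `2 / t k ^ 2` matches the denominator of the second subderivative. -/
theorem tendsto_secondDifferenceQuotient {g : E → E'} (hg : ContDiff ℝ 2 g)
    (htpos : ∀ k, 0 < t k) (ht : Tendsto t atTop (𝓝 0)) (hv : Tendsto v atTop (𝓝 w)) :
    Tendsto (fun k => (2 / t k ^ 2) • (g (x + t k • v k) - g x - t k • fderiv ℝ g x (v k)))
      atTop (𝓝 (fderiv ℝ (fderiv ℝ g) x w w)) := by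
  set B := fderiv ℝ (fderiv ℝ g) x
  have hlit : (fun k => g (x + t k • v k) - g x - fderiv ℝ g x (t k • v k)
      - (1 / 2 : ℝ) • B (t k • v k) (t k • v k)) =o[atTop] fun k => t k ^ 2 := by
    have h1 := (isLittleO_taylor_two hg x).comp_tendsto (tendsto_add_smul (x := x) ht hv)
    have h2 : (fun k => t k • v k) =O[atTop] t := by
      simpa using (isBigO_refl t atTop).smul (hv.isBigO_one ℝ)
    exact IsLittleO.trans_isBigO (by simpa only [Function.comp_def, add_sub_cancel_left] using h1)
      (h2.norm_left.pow 2)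
  have h3 : Tendsto (fun k => B (v k) (v k)) atTop (𝓝 (B w w)) :=
    ((B.continuous.clm_apply continuous_id).tendsto w).comp hv
  have h4 := (hlit.tendsto_inv_smul_nhds_zero.const_smul (2 : ℝ)).add h3
  simp only [zero_add, smul_zero] at h4
  refine h4.congr fun k => ?_
  have ht2 : (t k) ≠ 0 := (htpos k).ne'
  have h5 : (2 / t k ^ 2) • (1 / 2 : ℝ) • B (t k • v k) (t k • v k) = B (v k) (v k) := by
    simp only [map_smul, smul_apply, smul_smul]
    rw [show 2 / t k ^ 2 * (1 / 2 * (t k * t k)) = 1 by field_simp, one_smul]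
  rw [smul_smul, ← div_eq_mul_inv, smul_sub (2 / t k ^ 2) _ ((1 / 2 : ℝ) • _), h5,
    sub_add_cancel, map_smul]

end Taylor

section Sequences

/-- On points of `S` the indicator vanishes and only the linear term of the quotient survives; a
lower limit is at most the one along any admissible sequence. -/
theorem secondSubderiv_indicatorFun_le {E : Type*} [NormedAddCommGroup E] [InnerProductSpace ℝ E]
    {S : Set E} {x y w : E} {t : ℕ → ℝ} {v : ℕ → E} {s : ℕ → ℝ} {a : ℝ} (hx : x ∈ S)
    (htpos : ∀ k, 0 < t k) (ht : Tendsto t atTop (𝓝 0)) (hv : Tendsto v atTop (𝓝 w))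
    (hmem : ∀ k, x + t k • v k ∈ S) (hle : ∀ k, -(2 / t k ^ 2 * inner ℝ y (t k • v k)) ≤ s k)
    (hs : Tendsto s atTop (𝓝 a)) :
    secondSubderiv (indicatorFun S) x y w ≤ a := by
  have htv : Tendsto (fun k => (t k, v k)) atTop (𝓝[>] (0 : ℝ) ×ˢ 𝓝 w) :=
    (tendsto_nhdsWithin_iff.2 ⟨ht, Eventually.of_forall htpos⟩).prodMk hv
  have hsE : Tendsto (fun k => (s k : EReal)) atTop (𝓝 (a : EReal)) :=
    (continuous_coe_real_ereal.tendsto a).comp hs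
  rw [← hsE.liminf_eq]
  refine (liminf_le_liminf_of_le htv).trans ?_
  rw [liminf, map_map]
  refine liminf_le_liminf (Eventually.of_forall fun k => ?_) (by isBoundedDefault)
    (by isBoundedDefault)
  simp only [Function.comp_apply, indicatorFun, hmem k, hx, if_true, sub_zero, zero_sub]
  rw [← EReal.coe_neg, ← EReal.coe_div, EReal.coe_le_coe_iff]
  refine le_of_eq_of_le ?_ (hle k)
  have := (htpos k).ne'
  rw [inner_smul_right]
  field_simp

variable {X Y Z P : Type*}
  [NormedAddCommGroup X] [InnerProductSpace ℝ X]
  [NormedAddCommGroup Y] [NormedAddCommGroup Z] [InnerProductSpace ℝ Z] [NormedAddCommGroup P]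
  {f₀ : X → ℝ} {F : X → Y} {G : Z → P} {H : Z → Y} {C : Set Y} {D : Set P} {x : X}

/-- If quadratic growth fails at a feasible point, it fails along a sequence with a convergent
direction of unit length. -/
theorem exists_seq_of_not_isEssentialLocalMin [ProperSpace X] (hx : F x ∈ C)
    (hnot : ¬ IsEssentialLocalMin f₀ F C x) :
    ∃ (t : ℕ → ℝ) (u : ℕ → X) (y : ℕ → Y) (r : ℕ → ℝ) (u₀ : X), (∀ k, 0 < t k) ∧
      Tendsto t atTop (𝓝 0) ∧ Tendsto u atTop (𝓝 u₀) ∧ Tendsto r atTop (𝓝 0) ∧ u₀ ≠ 0 ∧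
      (∀ k, y k ∈ C) ∧ (∀ k, f₀ (x + t k • u k) - f₀ x ≤ r k * t k ^ 2) ∧
      ∀ k, ‖F (x + t k • u k) - y k‖ ≤ r k * t k ^ 2 := by
  have hseq : ∀ k : ℕ, ∃ x' : X, ∃ y ∈ C, ‖x' - x‖ ≤ 1 / ((k : ℝ) + 1) ∧ 0 < ‖x' - x‖ ∧
      f₀ x' - f₀ x ≤ 1 / ((k : ℝ) + 1) * ‖x' - x‖ ^ 2 ∧
      ‖F x' - y‖ ≤ 1 / ((k : ℝ) + 1) * ‖x' - x‖ ^ 2 := by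
    intro k
    have hk : 0 < 1 / ((k : ℝ) + 1) := Nat.one_div_pos_of_nat
    by_contra hcon
    refine hnot ⟨hx, _, hk, _, hk, fun x' hx' => ?_⟩
    by_contra! hlt
    obtain ⟨hf, hd⟩ := max_lt_iff.1 hlt
    obtain ⟨y, hy, hdist⟩ := (Metric.infDist_lt_iff ⟨_, hx⟩).1 hd
    refine hcon ⟨x', y, hy, by simpa [dist_eq_norm] using hx', ?_, hf.le, ?_⟩
    -- At `x' = x` the strict bound would make the distance negative.
    · refine (norm_nonneg _).lt_of_ne fun h0 => ?_
      rw [← h0] at hd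
      simpa using hd.trans_le' Metric.infDist_nonneg
    · rw [← dist_eq_norm]; exact hdist.le
  choose x' y hy hsmall hpos hf hF using hseq
  obtain ⟨u₀, hu₀, φ, hφ, hlim⟩ := (isCompact_sphere (0 : X) 1).tendsto_subseq
    (x := fun k => ‖x' k - x‖⁻¹ • (x' k - x)) fun k => by
      simp [norm_smul, inv_mul_cancel₀ (hpos k).ne']
  have ht : Tendsto (fun k => ‖x' k - x‖) atTop (𝓝 0) :=
    squeeze_zero (fun _ => norm_nonneg _) hsmall tendsto_one_div_add_atTop_nhds_zero_nat
  have hrec : ∀ k, x + ‖x' k - x‖ • ‖x' k - x‖⁻¹ • (x' k - x) = x' k := fun k => by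
    rw [smul_inv_smul₀ (hpos k).ne', add_sub_cancel]
  refine ⟨fun k => ‖x' (φ k) - x‖, fun k => ‖x' (φ k) - x‖⁻¹ • (x' (φ k) - x), fun k => y (φ k),
    fun k => 1 / ((φ k : ℝ) + 1), u₀, fun k => hpos _, ht.comp hφ.tendsto_atTop, hlim,
    tendsto_one_div_add_atTop_nhds_zero_nat.comp hφ.tendsto_atTop,
    ne_zero_of_mem_unit_sphere ⟨u₀, hu₀⟩, fun k => hy _, fun k => ?_, fun k => ?_⟩
  · simpa only [hrec] using hf (φ k)
  · simpa only [hrec] using hF (φ k)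

variable [InnerProductSpace ℝ Y]

/-- Under inner calmness*, a failure of quadratic growth lifts to the space of the variable `z`. -/
theorem exists_lifted_seq_of_not_isEssentialLocalMin [ProperSpace X] [ProperSpace Z]
    (hF : DifferentiableAt ℝ F x) (hG : Continuous G) (hH : Continuous H) (hD : IsClosed D)
    (hx : F x ∈ imagePreimage G H D)
    (hcalm : InnerCalmStarAt (implicitMap G H D) (F x) (imagePreimage G H D))
    (hnot : ¬ IsEssentialLocalMin f₀ F (imagePreimage G H D) x) :
    ∃ (t : ℕ → ℝ) (u : ℕ → X) (w : ℕ → Z) (r : ℕ → ℝ) (u₀ : X) (w₀ z : Z), (∀ k, 0 < t k) ∧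
      Tendsto t atTop (𝓝 0) ∧ Tendsto u atTop (𝓝 u₀) ∧ Tendsto w atTop (𝓝 w₀) ∧
      Tendsto r atTop (𝓝 0) ∧ u₀ ≠ 0 ∧ z ∈ implicitMap G H D (F x) ∧
      (∀ k, G (z + t k • w k) ∈ D) ∧ (∀ k, f₀ (x + t k • u k) - f₀ x ≤ r k * t k ^ 2) ∧
      ∀ k, ‖F (x + t k • u k) - H (z + t k • w k)‖ ≤ r k * t k ^ 2 := by
  obtain ⟨t, u, y, r, u₀, htpos, ht, hu, hr, hu₀, hy, hf, hFy⟩ :=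
    exists_seq_of_not_isEssentialLocalMin hx hnot
  have hres : Tendsto (fun k => (t k)⁻¹ • (F (x + t k • u k) - y k)) atTop (𝓝 0) := by
    refine squeeze_zero_norm (fun k => ?_) (by simpa using hr.mul ht)
    rw [norm_smul, norm_inv, Real.norm_of_nonneg (htpos k).le, inv_mul_le_iff₀ (htpos k)]
    exact (hFy k).trans_eq (by ring)
  have hquot : Tendsto (fun k => (t k)⁻¹ • (y k - F x)) atTop (𝓝 (fderiv ℝ F x u₀)) := by
    have h := (tendsto_differenceQuotient hF htpos ht hu).sub hres
    rw [sub_zero] at h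
    refine h.congr fun k => ?_
    rw [← smul_sub]; congr 1; abel
  have hyF : Tendsto y atTop (𝓝 (F x)) := by
    have h := (ht.smul hquot).const_add (F x)
    rw [zero_smul, add_zero] at h
    refine h.congr fun k => ?_
    rw [smul_inv_smul₀ (htpos k).ne', add_sub_cancel]
  obtain ⟨κ, hκ, hcalm⟩ := hcalm
  obtain ⟨z, φ, zs, hφ, hzs, hmem⟩ := hcalm y hy hyF
  obtain ⟨M, hM⟩ := (Metric.isBounded_range_of_tendsto _ hquot).exists_norm_le
  -- Calmness* bounds the scaled displacements by `κ * M`, since the quotients of `y` converge.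
  obtain ⟨w₀, -, ψ, hψ, hw⟩ := tendsto_subseq_of_bounded
    (Metric.isBounded_closedBall (x := (0 : Z)) (r := κ * M))
    (x := fun k => (t (φ k))⁻¹ • (zs k - z)) fun k => by
      have h1 := hM _ (mem_range_self (φ k))
      rw [norm_smul, norm_inv, Real.norm_of_nonneg (htpos _).le] at h1
      rw [mem_closedBall_zero_iff, norm_smul, norm_inv, Real.norm_of_nonneg (htpos _).le]
      calc (t (φ k))⁻¹ * ‖zs k - z‖ ≤ (t (φ k))⁻¹ * (κ * ‖y (φ k) - F x‖) :=
            mul_le_mul_of_nonneg_left (hmem k).2 (inv_nonneg.2 (htpos _).le)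
        _ = κ * ((t (φ k))⁻¹ * ‖y (φ k) - F x‖) := by ring
        _ ≤ κ * M := mul_le_mul_of_nonneg_left h1 hκ.le
  have hχ : Tendsto (fun k => φ (ψ k)) atTop atTop := hφ.tendsto_atTop.comp hψ.tendsto_atTop
  have hrec : ∀ k, z + t (φ k) • (t (φ k))⁻¹ • (zs k - z) = zs k := fun k => by
    rw [smul_inv_smul₀ (htpos _).ne', add_sub_cancel]
  refine ⟨fun k => t (φ (ψ k)), fun k => u (φ (ψ k)),
    fun k => (t (φ (ψ k)))⁻¹ • (zs (ψ k) - z), fun k => r (φ (ψ k)), u₀, w₀, z,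
    fun k => htpos _, ht.comp hχ, hu.comp hχ, hw, hr.comp hχ, hu₀, ⟨?_, ?_⟩, fun k => ?_,
    fun k => hf _, fun k => ?_⟩
  · exact hD.mem_of_tendsto ((hG.tendsto z).comp hzs) (Eventually.of_forall fun k => (hmem k).1.1)
  · refine tendsto_nhds_unique ((hH.tendsto z).comp hzs) ?_
    exact (hyF.comp hφ.tendsto_atTop).congr fun k => (hmem k).1.2.symm
  · simpa only [hrec] using (hmem (ψ k)).1.1
  · simpa only [hrec, (hmem (ψ k)).1.2] using hFy (φ (ψ k))

variable [InnerProductSpace ℝ P] [CompleteSpace X] [CompleteSpace Y] [CompleteSpace Z] [CompleteSpace P]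
  {t r : ℕ → ℝ} {u : ℕ → X} {w : ℕ → Z} {u₀ : X} {w₀ z : Z}

/-- Along a sequence on which quadratic growth fails, the second-order expression of the sufficient
condition is nonpositive. -/
theorem hessForm_lagrangian_add_theta_nonpos
    (hf₀ : ContDiff ℝ 2 f₀) (hF : ContDiff ℝ 2 F) (hG : ContDiff ℝ 2 G) (hH : ContDiff ℝ 2 H)
    (htpos : ∀ k, 0 < t k) (ht : Tendsto t atTop (𝓝 0)) (hu : Tendsto u atTop (𝓝 u₀))
    (hw : Tendsto w atTop (𝓝 w₀)) (hr : Tendsto r atTop (𝓝 0))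
    (hz : z ∈ implicitMap G H D (F x)) (hmem : ∀ k, G (z + t k • w k) ∈ D)
    (hf : ∀ k, f₀ (x + t k • u k) - f₀ x ≤ r k * t k ^ 2)
    (hFH : ∀ k, ‖F (x + t k • u k) - H (z + t k • w k)‖ ≤ r k * t k ^ 2)
    {α : ℝ} (hα : 0 ≤ α) {lam : Y} (hlam : lam ∈ multipliers f₀ F α x) {η : P}
    (hη : (fderiv ℝ G z).adjoint η = (fderiv ℝ H z).adjoint lam) :
    ((hessForm (fun x => lagrangian f₀ F α x lam) x u₀ : ℝ) : EReal)
      + theta G H D z w₀ lam η ≤ 0 := by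
  set L : X → ℝ := fun x => lagrangian f₀ F α x lam
  have hLc : ContDiff ℝ 2 L := (contDiff_const.mul hf₀).add (contDiff_const.inner ℝ hF)
  have hL' : fderiv ℝ L x = 0 := by
    have h : gradient L x = 0 := hlam
    simpa [gradient] using h
  have hA := tendsto_secondDifferenceQuotient (x := x) hLc htpos ht hu
  have hB := tendsto_secondDifferenceQuotient (x := z) hG htpos ht hw
  have hC := tendsto_secondDifferenceQuotient (x := z) hH htpos ht hw
  -- The last summand absorbs the errors in `f₀` and `F`, weighted by `α` and `‖lam‖`; it vanishes
  -- in the limit.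
  have hs := ((((tendsto_const_nhds (x := lam)).inner hC).sub
    ((tendsto_const_nhds (x := η)).inner hB)).sub hA).add (hr.const_mul (2 * (α + ‖lam‖)))
  have hle := secondSubderiv_indicatorFun_le (y := η) hz.1 htpos ht
    (tendsto_differenceQuotient (hG.differentiable (by norm_num) z) htpos ht hw)
    (fun k => by rw [smul_inv_smul₀ (htpos k).ne', add_sub_cancel]; exact hmem k)
    (fun k => ?_) hs
  · have hsum := add_le_add_right (add_le_add_right hle
      ((inner ℝ η (hessForm G z w₀) - inner ℝ lam (hessForm H z w₀) : ℝ) : EReal))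
      ((hessForm L x u₀ : ℝ) : EReal)
    refine hsum.trans_eq ?_
    simp only [hessForm]
    rw [← EReal.coe_add, ← EReal.coe_add, ← EReal.coe_zero]
    congr 1
    ring
  · have htk := htpos k
    -- Cancels the first-order terms of `G` and `H` exactly at each `w k`.
    have hadj : inner ℝ η (fderiv ℝ G z (w k)) = inner ℝ lam (fderiv ℝ H z (w k)) := by
      rw [← ContinuousLinearMap.adjoint_inner_left, hη, ContinuousLinearMap.adjoint_inner_left]
    have hCS : inner ℝ lam (F (x + t k • u k) - H (z + t k • w k)) ≤ ‖lam‖ * (r k * t k ^ 2) :=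
      (real_inner_le_norm _ _).trans (mul_le_mul_of_nonneg_left (hFH k) (norm_nonneg _))
    have hLk : L (x + t k • u k) - L x ≤
        (α + ‖lam‖) * (r k * t k ^ 2) + inner ℝ lam (H (z + t k • w k) - H z) := by
      have h1 := mul_le_mul_of_nonneg_left (hf k) hα
      have h2 : H z = F x := hz.2
      simp only [L, lagrangian, h2, inner_sub_right] at hCS ⊢
      linarith
    have hkey := mul_le_mul_of_nonneg_left hLk (by positivity : 0 ≤ 2 / t k ^ 2)
    have hrk : 2 / t k ^ 2 * ((α + ‖lam‖) * (r k * t k ^ 2)) = 2 * (α + ‖lam‖) * r k := by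
      field_simp
    rw [mul_add, hrk] at hkey
    rw [smul_inv_smul₀ htk.ne', hL']
    simp only [inner_smul_right, inner_sub_right, zero_apply, smul_eq_mul,
      hadj] at hkey ⊢
    linarith

end Sequences

end SecondOrder

set_option linter.unusedVariables false in
theorem theorem5p12 {n m l p : ℕ}
    (f₀ : EuclideanSpace ℝ (Fin n) → ℝ)
    (F : EuclideanSpace ℝ (Fin n) → EuclideanSpace ℝ (Fin m))
    (G : EuclideanSpace ℝ (Fin l) → EuclideanSpace ℝ (Fin p))
    (H : EuclideanSpace ℝ (Fin l) → EuclideanSpace ℝ (Fin m))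
    (D : Set (EuclideanSpace ℝ (Fin p)))
    (hf₀ : ContDiff ℝ 2 f₀) (hF : ContDiff ℝ 2 F) (hG : ContDiff ℝ 2 G) (hH : ContDiff ℝ 2 H)
    (hD : IsClosed D)
    (xbar : EuclideanSpace ℝ (Fin n))
    (hfeas : F xbar ∈ SecondOrder.imagePreimage G H D)
    (hsemi : SecondOrder.InnerSemicompactAt (SecondOrder.implicitMap G H D) (F xbar)
      (SecondOrder.imagePreimage G H D))
    (hcalm : SecondOrder.InnerCalmStarAt (SecondOrder.implicitMap G H D) (F xbar)
      (SecondOrder.imagePreimage G H D))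
    (hsosc : ∀ u : EuclideanSpace ℝ (Fin n), u ≠ 0 →
      (∃ z ∈ SecondOrder.implicitMap G H D (F xbar), ∃ w : EuclideanSpace ℝ (Fin l),
        fderiv ℝ G z w ∈ SecondOrder.tangentCone D (G z) ∧
        fderiv ℝ F xbar u = fderiv ℝ H z w) →
      inner ℝ (gradient f₀ xbar) u ≤ 0 →
      ∃ α : ℝ, 0 ≤ α ∧ ∃ lam ∈ SecondOrder.multipliers f₀ F α xbar,
        ∀ z ∈ SecondOrder.implicitMap G H D (F xbar), ∀ w : EuclideanSpace ℝ (Fin l),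
          fderiv ℝ H z w = fderiv ℝ F xbar u →
          fderiv ℝ G z w ∈ SecondOrder.tangentCone D (G z) →
          ∃ η ∈ SecondOrder.innerMultipliers G H D z w lam,
            (0 : EReal) <
              ((SecondOrder.hessForm (fun x => SecondOrder.lagrangian f₀ F α x lam) xbar u : ℝ) :
                EReal) + SecondOrder.theta G H D z w lam η) :
    SecondOrder.IsEssentialLocalMin f₀ F (SecondOrder.imagePreimage G H D) xbar := by
  by_contra hnot
  obtain ⟨t, u, w, r, u₀, w₀, z, htpos, ht, hu, hw, hr, hu₀, hz, hmem, hf, hFH⟩ :=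
    SecondOrder.exists_lifted_seq_of_not_isEssentialLocalMin
      (hF.differentiable (by norm_num) xbar) hG.continuous hH.continuous hD hfeas hcalm hnot
  have htr : Tendsto (fun k => r k * t k) atTop (𝓝 0) := by simpa using hr.mul ht
  have htan : fderiv ℝ G z w₀ ∈ SecondOrder.tangentCone D (G z) := by
    refine ⟨t, _, htpos, ht, SecondOrder.tendsto_differenceQuotient
      (hG.differentiable (by norm_num) z) htpos ht hw, fun k => ?_⟩
    rw [smul_inv_smul₀ (htpos k).ne', add_sub_cancel]
    exact hmem k
  have hFHd : fderiv ℝ F xbar u₀ = fderiv ℝ H z w₀ := by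
    refine sub_eq_zero.1 (tendsto_nhds_unique
      ((SecondOrder.tendsto_differenceQuotient (hF.differentiable (by norm_num) xbar)
        htpos ht hu).sub (SecondOrder.tendsto_differenceQuotient
        (hH.differentiable (by norm_num) z) htpos ht hw)) ?_)
    refine squeeze_zero_norm (fun k => ?_) htr
    rw [← smul_sub, hz.2, sub_sub_sub_cancel_right, norm_smul, norm_inv,
      Real.norm_of_nonneg (htpos k).le, inv_mul_le_iff₀ (htpos k)]
    exact (hFH k).trans_eq (by ring)
  have hdesc : inner ℝ (gradient f₀ xbar) u₀ ≤ 0 := by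
    rw [gradient, InnerProductSpace.toDual_symm_apply]
    refine le_of_tendsto_of_tendsto' (SecondOrder.tendsto_differenceQuotient
      (hf₀.differentiable (by norm_num) xbar) htpos ht hu) htr fun k => ?_
    rw [smul_eq_mul, inv_mul_le_iff₀ (htpos k)]
    exact (hf k).trans_eq (by ring)
  obtain ⟨α, hα, lam, hlam, hsec⟩ := hsosc u₀ hu₀ ⟨z, hz, w₀, htan, hFHd⟩ hdesc
  obtain ⟨η, hη, hpos⟩ := hsec z hz w₀ hFHd.symm htan
  exact hpos.not_ge (SecondOrder.hessForm_lagrangian_add_theta_nonpos hf₀ hF hG hH htpos ht hu hw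
    hr hz hmem hf hFH hα hlam hη.2)
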